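/- Let $H$ be a finite abelian group of odd order, and let $S \subseteq H$ be a subset with $1_H \notin S$ and $x^{-1} \in S$ for every $x \in S$. Let $\mathrm{Cay}(H,S)$ be the graph with vertex set $H$ and edges $\{x, sx\}$ for $x \in H$ and $s \in S$. For a graph $\Gamma$, let $\Gamma \times K_2$ denote its canonical double cover, that is, the graph with vertex set $V(\Gamma) \times \{0,1\}$ and edges $\{(u,0),(v,1)\}$, where $u, v$ are adjacent in $\Gamma$. Call $\Gamma$ stable if $\mathrm{Aut}(\Gamma \times K_2) \cong \mathrm{Aut}(\Gamma) \times \mathbb{Z}_2$, and unstable otherwise. If $\mathrm{Cay}(H,S)$ is connected and unstable, then it has twins, i.e. there are two distinct vertices of $\mathrm{Cay}(H,S)$ with the same neighbourhood. -/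

import Mathlib

namespace SimpleGraph

/-- A graph is stable if the automorphism group of its canonical double cover `G × K₂`
is isomorphic, as a group, to `Aut(G) × ℤ₂`. The canonical double cover is Mathlib's
`bipartiteDoubleCover`, whose vertex set is two disjoint copies of `V` and whose edges join
`u` in one copy to `v` in the other copy exactly when `u` and `v` are adjacent in `G`. -/
def IsStable {V : Type*} (G : SimpleGraph V) : Prop :=
  Nonempty ((G.bipartiteDoubleCover ≃g G.bipartiteDoubleCover) ≃*
    (G ≃g G) × Multiplicative (ZMod 2))

/-- A graph is unstable if it is not stable. -/
def IsUnstable {V : Type*} (G : SimpleGraph V) : Prop :=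
  ¬ G.IsStable

/-- A graph has twins if two distinct vertices have the same neighbourhood. -/
def HasTwins {V : Type*} (G : SimpleGraph V) : Prop :=
  ∃ u v : V, u ≠ v ∧ G.neighborSet u = G.neighborSet v

end SimpleGraph

/-! Two-step paths are counted modulo 2. From `x` to `y` they are the `z` with `x⁻¹ * z` and `z⁻¹ *
y` in `T`. As `H` is abelian, `z ↦ x * y * z⁻¹` permutes them, and as `|H|` is odd its only fixed
point in `H` is the square root of `x * y`. So the count is odd iff `x⁻¹ * y` is the square of an
element of `T`. Two steps across the layers end in the starting layer, so an automorphism of the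
double cover preserves the same-layer relation of the squares of `S`, then of the `2 ^ k`-th powers
for all `k ≥ 1`. Some such power map is the identity, so it preserves two disjoint copies of the
Cayley graph. By connectedness it fixes or exchanges the copies, and without twins its two halves
agree, so it is a lift up to the exchange. -/

namespace SimpleGraph

variable {V : Type*} {G : SimpleGraph V}

/-- The automorphism of the canonical double cover acting as `a` on both layers. -/
def doubleCoverLift (a : G ≃g G) : G.bipartiteDoubleCover ≃g G.bipartiteDoubleCover where
  toEquiv := Equiv.sumCongr a.toEquiv a.toEquiv
  map_rel_iff' := by
    rintro (u | u) (v | v)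
    · simp
    · exact a.map_rel_iff
    · exact a.map_rel_iff
    · simp

/-- The automorphism of the canonical double cover exchanging the two layers. -/
def doubleCoverSwap (G : SimpleGraph V) : G.bipartiteDoubleCover ≃g G.bipartiteDoubleCover where
  toEquiv := Equiv.sumComm V V
  map_rel_iff' := by rintro (u | u) (v | v) <;> simp

@[simp]
theorem doubleCoverLift_inl (a : G ≃g G) (x : V) : doubleCoverLift a (.inl x) = .inl (a x) := rfl

@[simp]
theorem doubleCoverLift_inr (a : G ≃g G) (x : V) : doubleCoverLift a (.inr x) = .inr (a x) := rfl

@[simp]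
theorem doubleCoverSwap_inl (x : V) : doubleCoverSwap G (.inl x) = .inr x := rfl

@[simp]
theorem doubleCoverSwap_inr (x : V) : doubleCoverSwap G (.inr x) = .inl x := rfl

/-- The obvious action of `Aut(G) × ℤ₂` on the canonical double cover. -/
def doubleCoverHom (G : SimpleGraph V) : (G ≃g G) × Multiplicative (ZMod 2) →*
    (G.bipartiteDoubleCover ≃g G.bipartiteDoubleCover) :=
  MonoidHom.mk' (fun p ↦ if p.2 = 1 then doubleCoverLift p.1
    else doubleCoverSwap G * doubleCoverLift p.1) <| by
      rintro ⟨a, e⟩ ⟨b, f⟩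
      have key : ∀ e : Multiplicative (ZMod 2), e = 1 ∨ e = Multiplicative.ofAdd 1 := by decide
      have h1 : (Multiplicative.ofAdd 1 : Multiplicative (ZMod 2)) ≠ 1 := by decide
      have h2 : (Multiplicative.ofAdd 1 * Multiplicative.ofAdd 1 : Multiplicative (ZMod 2)) = 1 := by
        decide
      ext (x | x) <;> rcases key e with rfl | rfl <;> rcases key f with rfl | rfl <;>
        simp [-bipartiteDoubleCover, h1, h2, RelIso.mul_apply]

theorem doubleCoverHom_injective [Nonempty V] : Function.Injective (doubleCoverHom G) := by
  obtain ⟨x₀⟩ := ‹Nonempty V›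
  rw [injective_iff_map_eq_one]
  rintro ⟨a, e⟩ h
  have key : ∀ x, doubleCoverHom G (a, e) (.inl x) = .inl x := fun x ↦ by rw [h]; rfl
  by_cases he : e = 1
  · simp only [doubleCoverHom, MonoidHom.mk'_apply, he, if_true, doubleCoverLift_inl,
      Sum.inl.injEq] at key
    exact Prod.ext (RelIso.ext key) he
  · have := key x₀
    simp [-bipartiteDoubleCover, doubleCoverHom, he, RelIso.mul_apply] at this

/-- A graph is stable once every automorphism of its double cover is, up to exchanging the
layers, a lift. -/
theorem isStable_of_forall_lift [Nonempty V]
    (h : ∀ φ : G.bipartiteDoubleCover ≃g G.bipartiteDoubleCover,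
      ∃ a : G ≃g G, φ = doubleCoverLift a ∨ φ = doubleCoverSwap G * doubleCoverLift a) :
    G.IsStable := by
  refine ⟨(MulEquiv.ofBijective (doubleCoverHom G) ⟨doubleCoverHom_injective, fun φ ↦ ?_⟩).symm⟩
  have h1 : (Multiplicative.ofAdd 1 : Multiplicative (ZMod 2)) ≠ 1 := by decide
  obtain ⟨a, rfl | rfl⟩ := h φ
  · exact ⟨(a, 1), by simp [-bipartiteDoubleCover, doubleCoverHom]⟩
  · exact ⟨(a, Multiplicative.ofAdd 1), by simp [-bipartiteDoubleCover, doubleCoverHom, h1]⟩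

/-- `φ` preserves and reflects adjacency in the disjoint union of two copies of `G`. -/
def PreservesLayerAdj (G : SimpleGraph V) (φ : V ⊕ V → V ⊕ V) : Prop :=
  ∀ u v, (G ⊕g G).Adj (φ u) (φ v) ↔ (G ⊕g G).Adj u v

theorem PreservesLayerAdj.isLeft_eq {φ : V ⊕ V → V ⊕ V} (h : G.PreservesLayerAdj φ)
    {u v : V ⊕ V} (huv : (G ⊕g G).Reachable u v) : (φ u).isLeft = (φ v).isLeft := by
  obtain ⟨w⟩ := huv
  induction w with
  | nil => rfl
  | cons hadj _ ih =>
    rw [← ih]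
    have := (h _ _).2 hadj
    revert this
    generalize φ _ = p
    generalize φ _ = q
    rcases p with p | p <;> rcases q with q | q <;> simp

theorem exists_eq_lift_of_isLeft (hconn : G.Connected) (htwin : ¬ G.HasTwins)
    (φ : G.bipartiteDoubleCover ≃g G.bipartiteDoubleCover) (h : G.PreservesLayerAdj φ)
    (x₀ : V) (hx₀ : (φ (.inl x₀)).isLeft) : ∃ a : G ≃g G, φ = doubleCoverLift a := by
  have hl : ∀ x, ∃ y, φ (.inl x) = .inl y := fun x ↦ by
    have := h.isLeft_eq ((hconn.preconnected x₀ x).map Embedding.sumInl.toHom)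
    exact Sum.isLeft_iff.1 (this ▸ hx₀)
  have hr : ∀ x, ∃ y, φ (.inr x) = .inr y := fun x ↦ by
    rw [← Sum.isRight_iff, ← Sum.not_isLeft]
    intro hx
    -- Something must map into the right copy, and the left copy does not; by connectedness the
    -- whole right copy follows.
    obtain ⟨z | z, hz⟩ := φ.surjective (.inr x₀)
    · obtain ⟨y, hy⟩ := hl z
      simp [-bipartiteDoubleCover, hy] at hz
    · have := h.isLeft_eq ((hconn.preconnected x z).map (Embedding.sumInr (G := G)).toHom)
      have h2 : (φ (.inr z)).isLeft := this ▸ hx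
      simp [-bipartiteDoubleCover, hz] at h2
  choose α hα using hl
  choose β hβ using hr
  have hαadj : ∀ x y, G.Adj (α x) (α y) ↔ G.Adj x y := fun x y ↦ by
    simpa [-bipartiteDoubleCover, hα] using h (.inl x) (.inl y)
  have hcross : ∀ x y, G.Adj (α x) (β y) ↔ G.Adj x y := fun x y ↦ by
    have := φ.map_rel_iff (a := .inl x) (b := .inr y)
    rw [hα, hβ] at this
    exact this
  have hsurj : Function.Surjective α := fun y ↦ by
    obtain ⟨z | z, hz⟩ := φ.surjective (.inl y)
    · exact ⟨z, by simpa [-bipartiteDoubleCover, hα] using hz⟩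
    · simp [-bipartiteDoubleCover, hβ] at hz
  have hinj : Function.Injective α := fun x y hxy ↦ by
    exact Sum.inl_injective (φ.injective (by rw [hα, hα, hxy]))
  -- `α x` is adjacent to `β y` iff `x` is to `y`, iff `α x` is to `α y`; as `α` is onto, `α y` and
  -- `β y` have the same neighbours.
  have hαβ : ∀ y, β y = α y := fun y ↦ by
    by_contra hne
    refine htwin ⟨_, _, hne, ?_⟩
    ext z
    obtain ⟨x, rfl⟩ := hsurj z
    rw [mem_neighborSet, mem_neighborSet, G.adj_comm, hcross, G.adj_comm (α y), hαadj]
  refine ⟨⟨Equiv.ofBijective α ⟨hinj, hsurj⟩, hαadj _ _⟩, ?_⟩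
  ext (x | x)
  · exact hα x
  · rw [hβ, hαβ]; rfl

theorem isStable_of_preservesLayerAdj (hconn : G.Connected) (htwin : ¬ G.HasTwins)
    (h : ∀ φ : G.bipartiteDoubleCover ≃g G.bipartiteDoubleCover, G.PreservesLayerAdj φ) :
    G.IsStable := by
  have := hconn.nonempty
  obtain ⟨x₀⟩ := hconn.nonempty
  refine isStable_of_forall_lift fun φ ↦ ?_
  cases hx₀ : (φ (.inl x₀)).isLeft
  · obtain ⟨a, ha⟩ := exists_eq_lift_of_isLeft hconn htwin (doubleCoverSwap G * φ) (h _) x₀ (by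
      rw [RelIso.mul_apply]
      revert hx₀
      generalize φ _ = p
      rcases p with p | p <;> simp [-bipartiteDoubleCover])
    refine ⟨a, .inr ?_⟩
    rw [← ha, ← mul_assoc]
    ext x
    rcases hx : φ x with p | p <;> simp [-bipartiteDoubleCover, RelIso.mul_apply, hx]
  · obtain ⟨a, ha⟩ := exists_eq_lift_of_isLeft hconn htwin φ (h _) x₀ hx₀
    exact ⟨a, .inl ha⟩

end SimpleGraph

/-- Relates `x` and `y` if the number of two-step `R`-paths from `x` to `y` is odd. -/
def OddTwoStep {W : Type*} (R : W → W → Prop) (x y : W) : Prop :=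
  Odd {z | R x z ∧ R z y}.ncard

theorem oddTwoStep_map_iff {W : Type*} {R : W → W → Prop} (φ : W ≃ W)
    (h : ∀ u v, R (φ u) (φ v) ↔ R u v) (x y : W) :
    OddTwoStep R (φ x) (φ y) ↔ OddTwoStep R x y := by
  have : {z | R (φ x) z ∧ R z (φ y)} = φ '' {z | R x z ∧ R z y} := by
    ext z
    obtain ⟨w, rfl⟩ := φ.surjective z
    simp [h]
  rw [OddTwoStep, OddTwoStep, this, Set.ncard_image_of_injective _ φ.injective]

/-! ### Parity of two-step paths and squares in groups of odd order -/

section Squares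

variable {H : Type*} [CommGroup H]

theorem odd_ncard_iff_exists_sq [Finite H] (hodd : Odd (Nat.card H)) (T : Set H) (x y : H) :
    Odd {z | x⁻¹ * z ∈ T ∧ z⁻¹ * y ∈ T}.ncard ↔ x⁻¹ * y ∈ (· ^ 2) '' T := by
  classical
  have := Fintype.ofFinite H
  have hbij : Function.Bijective (fun z : H ↦ z ^ 2) :=
    (powCoprime (Nat.coprime_two_right.2 hodd)).bijective
  obtain ⟨r, hr⟩ := hbij.2 (x * y)
  simp only at hr
  set A : Finset H := {z | x⁻¹ * z ∈ T ∧ z⁻¹ * y ∈ T} with hA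
  have hAc : {z | x⁻¹ * z ∈ T ∧ z⁻¹ * y ∈ T} = (A : Set H) := by simp [hA]
  have hinv : ∀ z, x * y * z⁻¹ = z ↔ z = r := fun z ↦ by
    rw [mul_inv_eq_iff_eq_mul, ← sq, ← hr]
    exact ⟨fun h ↦ (hbij.1 h).symm, fun h ↦ by rw [h]⟩
  have hmem : ∀ z ∈ A, x * y * z⁻¹ ∈ A := fun z hz ↦ by
    simp only [hA, Finset.mem_filter, Finset.mem_univ, true_and] at hz ⊢
    refine ⟨?_, ?_⟩
    · convert hz.2 using 1
      rw [mul_assoc, inv_mul_cancel_left, mul_comm]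
    · convert hz.1 using 1
      rw [mul_inv_rev, inv_inv, mul_inv, mul_assoc, inv_mul_cancel_right, mul_comm]
  -- Away from `r` the involution pairs off the elements of `A`.
  have heven : Even (A.erase r).card := by
    rw [← ZMod.natCast_eq_zero_iff_even, Finset.cast_card]
    refine Finset.sum_involution (fun z _ ↦ x * y * z⁻¹) (fun _ _ ↦ by decide) ?_ ?_ ?_
    · intro z hz _ h
      exact (Finset.mem_erase.1 hz).1 ((hinv z).1 h)
    · intro z hz
      rw [Finset.mem_erase] at hz ⊢
      refine ⟨fun h ↦ hz.1 ?_, hmem z hz.2⟩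
      have hrr := (hinv r).2 rfl
      rw [← h, mul_inv_rev, inv_inv, mul_comm z, mul_inv_cancel_left] at hrr
      rw [hrr, h]
    · intro z _
      rw [mul_inv_rev, inv_inv, mul_comm z, mul_inv_cancel_left]
  have hxr : ∀ t : H, t ^ 2 = x⁻¹ * y ↔ t = x⁻¹ * r := fun t ↦ by
    have : (x⁻¹ * r) ^ 2 = x⁻¹ * y := by
      rw [mul_pow, hr, sq, mul_assoc, inv_mul_cancel_left]
    rw [← this]
    exact hbij.1.eq_iff
  have hry : r⁻¹ * y = x⁻¹ * r := by
    rw [inv_mul_eq_iff_eq_mul, mul_left_comm, ← sq, hr, inv_mul_cancel_left]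
  have hrA : r ∈ A ↔ x⁻¹ * y ∈ (· ^ 2) '' T := by
    simp [hA, hxr, hry]
  rw [hAc, Set.ncard_coe_finset, ← hrA]
  by_cases h : r ∈ A
  · rw [← Finset.card_erase_add_one h]
    exact iff_of_true heven.add_one h
  · rw [Finset.erase_eq_of_notMem h] at heven
    simp [h, heven]

/-- On two copies of `H`: `x` and `y` lie in the same copy and `x⁻¹ * y ∈ T`. -/
def SameLayer (T : Set H) : H ⊕ H → H ⊕ H → Prop
  | .inl x, .inl y | .inr x, .inr y => x⁻¹ * y ∈ T
  | _, _ => False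

/-- On two copies of `H`: `x` and `y` lie in different copies and `x⁻¹ * y ∈ T`. -/
def CrossLayer (T : Set H) : H ⊕ H → H ⊕ H → Prop
  | .inl x, .inr y | .inr x, .inl y => x⁻¹ * y ∈ T
  | _, _ => False

theorem oddTwoStep_sameLayer [Finite H] (hodd : Odd (Nat.card H)) (T : Set H) :
    OddTwoStep (SameLayer T) = SameLayer ((· ^ 2) '' T) := by
  have hl : ∀ x y : H, {z | SameLayer T (.inl x) z ∧ SameLayer T z (.inl y)} =
      Sum.inl '' {z | x⁻¹ * z ∈ T ∧ z⁻¹ * y ∈ T} := fun x y ↦ by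
    ext (z | z) <;> simp [SameLayer]
  have hr : ∀ x y : H, {z | SameLayer T (.inr x) z ∧ SameLayer T z (.inr y)} =
      Sum.inr '' {z | x⁻¹ * z ∈ T ∧ z⁻¹ * y ∈ T} := fun x y ↦ by
    ext (z | z) <;> simp [SameLayer]
  have hlr : ∀ x y : H, {z | SameLayer T (.inl x) z ∧ SameLayer T z (.inr y)} = ∅ := fun x y ↦ by
    ext (z | z) <;> simp [SameLayer]
  have hrl : ∀ x y : H, {z | SameLayer T (.inr x) z ∧ SameLayer T z (.inl y)} = ∅ := fun x y ↦ by
    ext (z | z) <;> simp [SameLayer]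
  funext u v
  rcases u with x | x <;> rcases v with y | y <;> apply propext <;> rw [OddTwoStep]
  · rw [hl, Set.ncard_image_of_injective _ Sum.inl_injective, odd_ncard_iff_exists_sq hodd]; rfl
  · rw [hlr]; simp [SameLayer]
  · rw [hrl]; simp [SameLayer]
  · rw [hr, Set.ncard_image_of_injective _ Sum.inr_injective, odd_ncard_iff_exists_sq hodd]; rfl

theorem oddTwoStep_crossLayer [Finite H] (hodd : Odd (Nat.card H)) (T : Set H) :
    OddTwoStep (CrossLayer T) = SameLayer ((· ^ 2) '' T) := by
  have hl : ∀ x y : H, {z | CrossLayer T (.inl x) z ∧ CrossLayer T z (.inl y)} =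
      Sum.inr '' {z | x⁻¹ * z ∈ T ∧ z⁻¹ * y ∈ T} := fun x y ↦ by
    ext (z | z) <;> simp [CrossLayer]
  have hr : ∀ x y : H, {z | CrossLayer T (.inr x) z ∧ CrossLayer T z (.inr y)} =
      Sum.inl '' {z | x⁻¹ * z ∈ T ∧ z⁻¹ * y ∈ T} := fun x y ↦ by
    ext (z | z) <;> simp [CrossLayer]
  have hlr : ∀ x y : H, {z | CrossLayer T (.inl x) z ∧ CrossLayer T z (.inr y)} = ∅ :=
    fun x y ↦ by ext (z | z) <;> simp [CrossLayer]
  have hrl : ∀ x y : H, {z | CrossLayer T (.inr x) z ∧ CrossLayer T z (.inl y)} = ∅ :=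
    fun x y ↦ by ext (z | z) <;> simp [CrossLayer]
  funext u v
  rcases u with x | x <;> rcases v with y | y <;> apply propext <;> rw [OddTwoStep]
  · rw [hl, Set.ncard_image_of_injective _ Sum.inr_injective, odd_ncard_iff_exists_sq hodd]; rfl
  · rw [hlr]; simp [SameLayer]
  · rw [hrl]; simp [SameLayer]
  · rw [hr, Set.ncard_image_of_injective _ Sum.inl_injective, odd_ncard_iff_exists_sq hodd]; rfl

/-- The first squaring turns the cross relation into a same-layer one, hence the exponent `k + 1`;
each later squaring stays within the layers. -/
theorem sameLayer_pow_map_iff [Finite H] (hodd : Odd (Nat.card H)) {T : Set H}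
    (φ : H ⊕ H ≃ H ⊕ H) (h : ∀ u v, CrossLayer T (φ u) (φ v) ↔ CrossLayer T u v) (k : ℕ)
    (u v : H ⊕ H) :
    SameLayer ((· ^ 2 ^ (k + 1)) '' T) (φ u) (φ v) ↔ SameLayer ((· ^ 2 ^ (k + 1)) '' T) u v := by
  induction k generalizing u v with
  | zero =>
    simpa [oddTwoStep_crossLayer hodd] using oddTwoStep_map_iff φ h u v
  | succ k ih =>
    have key := oddTwoStep_map_iff φ ih u v
    rw [oddTwoStep_sameLayer hodd, Set.image_image] at key
    simpa only [← pow_mul, ← pow_succ] using key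

/-- A permutation preserving the relation across the layers preserves the one inside them. -/
theorem sameLayer_map_iff [Finite H] (hodd : Odd (Nat.card H)) {T : Set H}
    (φ : H ⊕ H ≃ H ⊕ H) (h : ∀ u v, CrossLayer T (φ u) (φ v) ↔ CrossLayer T u v)
    (u v : H ⊕ H) : SameLayer T (φ u) (φ v) ↔ SameLayer T u v := by
  -- By Euler, raising to the power `2 ^ φ(|H|)` is the identity on `H`; positivity of the totient
  -- supplies the at least one squaring needed.
  have hpos : 0 < (Nat.card H).totient := Nat.totient_pos.2 Nat.card_pos
  have hmod : 2 ^ (Nat.card H).totient ≡ 1 [MOD Nat.card H] :=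
    Nat.ModEq.pow_totient (Nat.coprime_two_left.2 hodd)
  have hpow : ∀ x : H, x ^ 2 ^ (Nat.card H).totient = x := fun x ↦ by
    conv_rhs => rw [← pow_one x]
    exact pow_eq_pow_iff_modEq.2 (hmod.of_dvd (orderOf_dvd_natCard x))
  have key := sameLayer_pow_map_iff hodd φ h ((Nat.card H).totient - 1) u v
  rw [Nat.sub_add_cancel hpos] at key
  simpa [hpow] using key

theorem mulCayley_adj_iff_inv_mul_mem {S : Set H} (hone : (1 : H) ∉ S)
    (hinv : ∀ x ∈ S, x⁻¹ ∈ S) (x y : H) :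
    (SimpleGraph.mulCayley S).Adj x y ↔ x⁻¹ * y ∈ S := by
  rw [SimpleGraph.mulCayley_adj']
  constructor
  · rintro ⟨-, g, hg, rfl | rfl⟩
    · simpa using hg
    · simpa using hinv g hg
  · refine fun h ↦ ⟨?_, _, h, .inl (mul_inv_cancel_left x y)⟩
    rintro rfl
    exact hone (by simpa using h)

end Squares

theorem theorem1p3 {H : Type*} [CommGroup H] [Finite H] (hodd : Odd (Nat.card H))
    (S : Set H) (hone : (1 : H) ∉ S) (hinv : ∀ x ∈ S, x⁻¹ ∈ S)
    (hconn : (SimpleGraph.mulCayley S).Connected)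
    (hunst : (SimpleGraph.mulCayley S).IsUnstable) :
    (SimpleGraph.mulCayley S).HasTwins := by
  by_contra htwin
  refine hunst (SimpleGraph.isStable_of_preservesLayerAdj hconn htwin fun φ ↦ ?_)
  have hadj := mulCayley_adj_iff_inv_mul_mem hone hinv
  have hcross : ∀ u v, (SimpleGraph.mulCayley S).bipartiteDoubleCover.Adj u v ↔
      CrossLayer S u v := by
    rintro (u | u) (v | v) <;> simp [CrossLayer, hadj]
  have hsame : ∀ u v, (SimpleGraph.mulCayley S ⊕g SimpleGraph.mulCayley S).Adj u v ↔
      SameLayer S u v := by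
    rintro (u | u) (v | v) <;> simp [SameLayer, hadj]
  intro u v
  rw [hsame, hsame]
  refine sameLayer_map_iff hodd φ.toEquiv (fun u v ↦ ?_) u v
  rw [← hcross, ← hcross]
  exact φ.map_rel_iff
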